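/- Let $\Omega\subset\mathbb R^d$ be a bounded domain, let $\tilde\Omega\subset\mathbb R^d$ be a bounded domain, and let $\bar\varepsilon>0$ be such that for every $x\in\Omega$ the cube $W(x)$ with centre $x$, side $\bar\varepsilon$ and sides parallel to the coordinate axes is contained in $\tilde\Omega$. Let $a_M:\tilde\Omega\to\mathbb R^{d\times d}$ be a measurable (not necessarily symmetric) matrix function for which there are constants $\alpha>0$ and $\beta$ with $$\alpha|\xi|^2\le \xi^T a_M(z)\xi,\qquad |a_M(z)\xi|\le\beta|\xi|\qquad\text{for a.e. } z\in\tilde\Omega\text{ and all }\xi\in\mathbb R^d .$$ Put $Y=(0,1)^d$. For $x\in\overline\Omega$ let $\tilde a(x,\cdot)$ be the function on $\mathbb R^d$, $\bar\varepsilon$-periodic in each coordinate, that equals $a_M$ (almost everywhere) on $W(x)$, and let $a(x,y):=\tilde a(x,\bar\varepsilon y)$ be the Continuous Extension of $a_M$, which is $Y$-periodic in $y$. Then for every $x\in\overline\Omega$ and $j=1,\dots,d$ the cell problem $$-\nabla_y\cdot\bigl(a(x,y)(\nabla_y w_j(x,y)+e_j)\bigr)=0\ \text{ in } Y,\qquad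 \int_Y w_j(x,y)\,dy=0,\qquad w_j(x,\cdot)\ Y\text{-periodic},$$ understood in the variational sense ($w_j(x,\cdot)\in H^1_{per}(Y)$ and $\int_Y\nabla\phi^T a(x,y)\nabla_y w_j\,dy=-\int_Y\nabla\phi^T a(x,y)e_j\,dy$ for all $\phi\in H^1_{per}(Y)$), has a solution, unique up to equality almost everywhere, and for all $i,j$ the averaged coefficient $$A_{ij}(x)=\int_Y e_i^T a(x,y)\bigl(\nabla_y w_j(x,y)+e_j\bigr)\,dy$$ is a continuous function of $x\in\overline\Omega$. -/

import Mathlib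

open MeasureTheory
open scoped ContDiff

noncomputable section

namespace TwoScale

/-- The half-open cube `W(x)` with centre `x`, side `ε` and sides parallel to the axes. -/
def cube {d : ℕ} (ε : ℝ) (x : EuclideanSpace ℝ (Fin d)) : Set (EuclideanSpace ℝ (Fin d)) :=
  {z | ∀ k, z k ∈ Set.Ico (x k - ε / 2) (x k + ε / 2)}

/-- The unique point of the cube `W(x)` that differs from `z` by an element of `ε ℤᵈ`. -/
def cubeRep {d : ℕ} {ε : ℝ} (hε : 0 < ε) (x z : EuclideanSpace ℝ (Fin d)) :
    EuclideanSpace ℝ (Fin d) :=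
  WithLp.toLp 2 fun k => toIcoMod hε (x k - ε / 2) (z k)

/-- `ã(x, ·)`: the `ε`-periodic function which equals `aM` on the cube `W(x)`. -/
def periodizedCoeff {d : ℕ} {ε : ℝ} (hε : 0 < ε)
    (aM : EuclideanSpace ℝ (Fin d) → Matrix (Fin d) (Fin d) ℝ)
    (x z : EuclideanSpace ℝ (Fin d)) : Matrix (Fin d) (Fin d) ℝ :=
  aM (cubeRep hε x z)

/-- The Continuous Extension `a(x, y) = ã(x, ε y)` of `aM`. -/
def continuousExtension {d : ℕ} {ε : ℝ} (hε : 0 < ε)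
    (aM : EuclideanSpace ℝ (Fin d) → Matrix (Fin d) (Fin d) ℝ)
    (x y : EuclideanSpace ℝ (Fin d)) : Matrix (Fin d) (Fin d) ℝ :=
  periodizedCoeff hε aM x (ε • y)

/-- The period `Y = (0,1)ᵈ`. -/
def unitCell (d : ℕ) : Set (EuclideanSpace ℝ (Fin d)) :=
  {y | ∀ k, y k ∈ Set.Ioo (0 : ℝ) 1}

/-- `Y`-periodicity: period `1` in every coordinate. -/
def IsYPeriodic {d : ℕ} (u : EuclideanSpace ℝ (Fin d) → ℝ) : Prop :=
  ∀ y k, u (y + EuclideanSpace.single k 1) = u y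

/-- `g` is the weak gradient of the periodic function `u`, i.e. its distributional gradient on the
torus `ℝᵈ / ℤᵈ`: the test functions are the smooth `Y`-periodic functions. -/
def IsWeakGradient {d : ℕ} (u : EuclideanSpace ℝ (Fin d) → ℝ)
    (g : EuclideanSpace ℝ (Fin d) → EuclideanSpace ℝ (Fin d)) : Prop :=
  ∀ φ : EuclideanSpace ℝ (Fin d) → ℝ, ContDiff ℝ ∞ φ → IsYPeriodic φ → ∀ k,
    ∫ y in unitCell d, u y * fderiv ℝ φ y (EuclideanSpace.single k 1)
      = - ∫ y in unitCell d, g y k * φ y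

/-- `u ∈ H¹_per(Y)`: `u` is `Y`-periodic, lies in `L²(Y)` and has a weak gradient in `L²(Y)`. -/
structure MemH1per {d : ℕ} (u : EuclideanSpace ℝ (Fin d) → ℝ) : Prop where
  periodic : IsYPeriodic u
  memLp : MemLp u 2 (volume.restrict (unitCell d))
  exists_grad : ∃ g : EuclideanSpace ℝ (Fin d) → EuclideanSpace ℝ (Fin d),
    MemLp g 2 (volume.restrict (unitCell d)) ∧ IsWeakGradient u g

open Classical in
/-- The weak gradient in `L²(Y)` of a function in `H¹_per(Y)` (a representative of it; the value
is `0` where there is no such gradient). -/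
def weakGradient {d : ℕ} (u : EuclideanSpace ℝ (Fin d) → ℝ) :
    EuclideanSpace ℝ (Fin d) → EuclideanSpace ℝ (Fin d) :=
  if h : ∃ g : EuclideanSpace ℝ (Fin d) → EuclideanSpace ℝ (Fin d),
      MemLp g 2 (volume.restrict (unitCell d)) ∧ IsWeakGradient u g
  then h.choose else 0

/-- `w` solves the `j`-th cell problem `-∇·(b(∇w + e_j)) = 0` in `Y`, with `w` periodic of zero
mean over `Y`, in the variational sense. -/
structure IsCellSolution {d : ℕ} (b : EuclideanSpace ℝ (Fin d) → Matrix (Fin d) (Fin d) ℝ)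
    (j : Fin d) (w : EuclideanSpace ℝ (Fin d) → ℝ) : Prop where
  memH1per : MemH1per w
  mean_zero : ∫ y in unitCell d, w y = 0
  weak_eq : ∀ φ : EuclideanSpace ℝ (Fin d) → ℝ, MemH1per φ →
    ∫ y in unitCell d,
        inner ℝ (weakGradient φ y) (Matrix.toEuclideanLin (b y) (weakGradient w y))
      = - ∫ y in unitCell d,
        inner ℝ (weakGradient φ y) (Matrix.toEuclideanLin (b y) (EuclideanSpace.single j 1))

open Classical in
/-- The solution of the `j`-th cell problem (`0` if there is none). -/
def cellSolution {d : ℕ} (b : EuclideanSpace ℝ (Fin d) → Matrix (Fin d) (Fin d) ℝ)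
    (j : Fin d) : EuclideanSpace ℝ (Fin d) → ℝ :=
  if h : ∃ w, IsCellSolution b j w then h.choose else 0

/-- The averaged coefficient `∫_Y e_iᵀ b(y) (∇w_j(y) + e_j) dy` of a `Y`-periodic coefficient. -/
def averagedCoeff {d : ℕ} (b : EuclideanSpace ℝ (Fin d) → Matrix (Fin d) (Fin d) ℝ)
    (i j : Fin d) : ℝ :=
  ∫ y in unitCell d,
    inner ℝ (EuclideanSpace.single i (1 : ℝ))
      (Matrix.toEuclideanLin (b y)
        (weakGradient (cellSolution b j) y + EuclideanSpace.single j 1))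

end TwoScale

end

/-! The value $a(x,y)$ is $a_M$ at the point of $W(x)$ congruent to $\bar\varepsilon y$ modulo
$\bar\varepsilon\mathbb Z^d$. Unless that point lies on the boundary of $W(x)$, which happens only
for a null set of $y$, the same point represents $\bar\varepsilon y$ in $W(x')$ for all $x'$ near
$x$ (`ae_cubeRep_mem_Ioo`, `eventually_cubeRep_eq`). So for almost every $y$ the map $x'\mapsto
a(x',y)$ is constant near $x$, although $a_M$ is merely measurable. With the uniform bound $\beta$,
dominated convergence gives strong convergence of the multiplication operators $B_{x'}\to B_x$ on
$L^2(Y)$ (`tendsto_mulOperator`).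

Strong convergence suffices. Let $V\subset L^2(Y)^d$ be the space of periodic gradients. The cell
problem asks for $g_x\in V$ with $B_x(g_x+e_j)\perp V$, which Lax–Milgram solves uniquely once $V$
is closed. Subtracting the equations at $x'$ and $x$ and testing with $g_{x'}-g_x$ bounds this
difference by $\alpha^{-1}\|(B_{x'}-B_x)(g_x+e_j)\|$, where the vector $g_x+e_j$ is fixed. Hence the
fluxes converge in $L^2$ (`tendsto_flux`), and $A_{ij}$ is the inner product of the flux with the
constant field $e_i$.

Closedness of $V$ and recovery of $w_j$ from its gradient both rest on Poincaré's inequality for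
mean-zero periodic functions. It follows from Parseval, since the gradient has Fourier coefficients
$2\pi i n_k\hat u(n)$. -/

namespace TwoScale

attribute [local instance] instMeasureSpaceUnitAddCircle

/-! ### The unit cell, the torus and Parseval's identity -/

theorem measurableSet_unitCell (d : ℕ) : MeasurableSet (unitCell d) := by
  have : unitCell d = ⋂ k, (fun y : EuclideanSpace ℝ (Fin d) => y k) ⁻¹' Set.Ioo (0 : ℝ) 1 := by
    ext y
    simp [unitCell]
  rw [this]
  exact MeasurableSet.iInter fun k => measurableSet_Ioo.preimage (by fun_prop)

theorem unitCell_subset_closedBall (d : ℕ) :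
    unitCell d ⊆ Metric.closedBall 0 (Real.sqrt d) := by
  intro y hy
  rw [mem_closedBall_zero_iff, EuclideanSpace.norm_eq]
  refine Real.sqrt_le_sqrt ?_
  calc ∑ i, ‖y i‖ ^ 2 ≤ ∑ _i : Fin d, (1 : ℝ) := by
        refine Finset.sum_le_sum fun i _ => ?_
        have := hy i
        rw [Real.norm_eq_abs, sq_abs]
        nlinarith [this.1, this.2]
    _ = d := by simp

instance isFiniteMeasure_restrict_unitCell (d : ℕ) :
    IsFiniteMeasure (volume.restrict (unitCell d)) :=
  ⟨by
    rw [Measure.restrict_apply_univ]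
    exact (measure_mono (unitCell_subset_closedBall d)).trans_lt measure_closedBall_lt_top⟩

theorem memLp_unitCell_of_continuous {d : ℕ} {F : Type*} [NormedAddCommGroup F]
    [SecondCountableTopologyEither (EuclideanSpace ℝ (Fin d)) F] {f : EuclideanSpace ℝ (Fin d) → F}
    (hf : Continuous f) (p : ENNReal) : MemLp f p (volume.restrict (unitCell d)) := by
  obtain ⟨C, hC⟩ := (isCompact_closedBall (0 : EuclideanSpace ℝ (Fin d))
    (Real.sqrt d)).exists_bound_of_continuousOn hf.continuousOn
  refine MemLp.of_bound hf.aestronglyMeasurable C ?_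
  filter_upwards [ae_restrict_mem (measurableSet_unitCell d)] with y hy
  exact hC y (unitCell_subset_closedBall d hy)

/-- The measurable section of the covering `ℝᵈ → ℝᵈ / ℤᵈ` with values in `(0, 1]ᵈ`. -/
noncomputable def torusSection (d : ℕ) (t : UnitAddTorus (Fin d)) : EuclideanSpace ℝ (Fin d) :=
  WithLp.toLp 2 (UnitAddTorus.measurableEquivPiIoc (fun _ => 0) t).1

theorem coe_torusSection {d : ℕ} (t : UnitAddTorus (Fin d)) :
    (fun k => (torusSection d t k : UnitAddCircle)) = t :=
  (UnitAddTorus.measurableEquivPiIoc (fun _ => 0)).symm_apply_apply t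

theorem unitCell_eq_preimage (d : ℕ) :
    unitCell d = WithLp.ofLp ⁻¹' (Set.univ.pi fun _ => Set.Ioo (0 : ℝ) 1) := by
  ext y
  simp [unitCell]

/-- This carries Fourier analysis from the torus to the cell. The section takes values in $(0,1]^d$,
which differs from $(0,1)^d$ by a null set. -/
theorem measurePreserving_torusSection (d : ℕ) :
    MeasurePreserving (torusSection d) volume (volume.restrict (unitCell d)) := by
  have h1 := UnitAddTorus.measurePreserving_equivPiIoc (fun _ : Fin d => (0 : ℝ))
  have hm : MeasurableSet {x : Fin d → ℝ | ∀ i, x i ∈ Set.Ioc (0 : ℝ) (0 + 1)} :=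
    MeasurableSet.univ_pi' fun i => measurableSet_Ioc
  have h2 : MeasurePreserving
      (Subtype.val : {x : Fin d → ℝ // ∀ i, x i ∈ Set.Ioc (0 : ℝ) (0 + 1)} → (Fin d → ℝ))
      (Measure.comap Subtype.val volume)
      (volume.restrict {x : Fin d → ℝ | ∀ i, x i ∈ Set.Ioc (0 : ℝ) (0 + 1)}) :=
    measurePreserving_subtype_coe hm
  have h3 : (volume.restrict {x : Fin d → ℝ | ∀ i, x i ∈ Set.Ioc (0 : ℝ) (0 + 1)})
      = volume.restrict (Set.univ.pi fun _ : Fin d => Set.Ioo (0 : ℝ) 1) := by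
    have e : {x : Fin d → ℝ | ∀ i, x i ∈ Set.Ioc (0 : ℝ) (0 + 1)}
        = Set.univ.pi fun _ => Set.Ioc (0 : ℝ) 1 := by
      ext x
      simp
    rw [e]
    exact Measure.restrict_congr_set
      ((Measure.univ_pi_Ioc_ae_eq_Icc (μ := fun _ : Fin d => (volume : Measure ℝ))
        (f := fun _ => 0) (g := fun _ => 1)).trans
      (Measure.univ_pi_Ioo_ae_eq_Icc (μ := fun _ : Fin d => (volume : Measure ℝ))
        (f := fun _ => 0) (g := fun _ => 1)).symm)
  have h4 : MeasurePreserving (WithLp.toLp 2 : (Fin d → ℝ) → EuclideanSpace ℝ (Fin d))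
      (volume.restrict (Set.univ.pi fun _ : Fin d => Set.Ioo (0 : ℝ) 1))
      (volume.restrict (unitCell d)) := by
    have := (PiLp.volume_preserving_toLp (Fin d)).restrict_preimage (measurableSet_unitCell d)
    rw [unitCell_eq_preimage] at this ⊢
    exact this
  rw [h3] at h2
  exact h4.comp (h2.comp h1)

/-- The exponential `exp (2 π i n · y)`. -/
noncomputable def cellChar {d : ℕ} (n : Fin d → ℤ) (y : EuclideanSpace ℝ (Fin d)) : ℂ :=
  Complex.exp (2 * Real.pi * Complex.I * ∑ k, (n k : ℂ) * (y k : ℂ))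

theorem mFourier_coe {d : ℕ} (n : Fin d → ℤ) (y : EuclideanSpace ℝ (Fin d)) :
    UnitAddTorus.mFourier n (fun k => (y k : UnitAddCircle)) = cellChar n y := by
  simp only [UnitAddTorus.mFourier, ContinuousMap.coe_mk, cellChar, Finset.mul_sum,
    Complex.exp_sum]
  refine Finset.prod_congr rfl fun k _ => ?_
  rw [fourier_coe_apply]
  congr 1
  push_cast
  ring

theorem contDiff_cellChar {d : ℕ} (n : Fin d → ℤ) : ContDiff ℝ ∞ (cellChar n) := by
  unfold cellChar
  refine ContDiff.cexp (contDiff_const.mul (ContDiff.sum fun k _ => contDiff_const.mul ?_))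
  exact Complex.ofRealCLM.contDiff.comp (EuclideanSpace.proj (𝕜 := ℝ) k).contDiff

theorem cellChar_add_single {d : ℕ} (n : Fin d → ℤ) (y : EuclideanSpace ℝ (Fin d)) (k : Fin d) :
    cellChar n (y + EuclideanSpace.single k 1) = cellChar n y := by
  rw [← mFourier_coe, ← mFourier_coe]
  congr 1
  ext i
  by_cases h : i = k
  · subst h
    simp
  · simp [h]

theorem fderiv_cellChar {d : ℕ} (n : Fin d → ℤ) (y : EuclideanSpace ℝ (Fin d)) (k : Fin d) :
    fderiv ℝ (cellChar n) y (EuclideanSpace.single k 1)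
      = 2 * Real.pi * Complex.I * n k * cellChar n y := by
  have hs : HasFDerivAt (fun y : EuclideanSpace ℝ (Fin d) => ∑ k, (n k : ℂ) * (y k : ℂ))
      (∑ k, (n k : ℂ) • Complex.ofRealCLM.comp (EuclideanSpace.proj (𝕜 := ℝ) k)) y :=
    HasFDerivAt.fun_sum fun k _ => HasFDerivAt.const_mul
      (Complex.ofRealCLM.comp (EuclideanSpace.proj (𝕜 := ℝ) k)).hasFDerivAt (n k : ℂ)
  have := ((hs.const_mul (2 * Real.pi * Complex.I)).cexp).fderiv
  unfold cellChar
  rw [this]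
  simp only [smul_apply, sum_apply,
    ContinuousLinearMap.comp_apply, PiLp.proj_apply, PiLp.single_apply, smul_eq_mul,
    Complex.ofRealCLM_apply]
  have hk : ∑ i, (n i : ℂ) * (((if i = k then 1 else 0 : ℝ)) : ℂ) = n k := by
    rw [Finset.sum_eq_single k (fun i _ hi => by simp [hi]) (by simp)]
    simp
  rw [hk]
  ring

/-- The Fourier coefficients over the unit cell. -/
noncomputable def cellCoeff {d : ℕ} (f : EuclideanSpace ℝ (Fin d) → ℂ) (n : Fin d → ℤ) : ℂ :=
  ∫ y in unitCell d, cellChar (-n) y * f y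

/-- Parseval's identity on the unit cell. -/
theorem hasSum_sq_cellCoeff {d : ℕ} {f : EuclideanSpace ℝ (Fin d) → ℂ}
    (hf : MemLp f 2 (volume.restrict (unitCell d))) :
    HasSum (fun n => ‖cellCoeff f n‖ ^ 2) (∫ y in unitCell d, ‖f y‖ ^ 2) := by
  have hs := measurePreserving_torusSection d
  have hF : MemLp (f ∘ torusSection d) 2 volume := hf.comp_measurePreserving hs
  have key := UnitAddTorus.hasSum_sq_mFourierCoeff (hF.toLp _)
  have hc : ∀ n, UnitAddTorus.mFourierCoeff (hF.toLp _) n = cellCoeff f n := by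
    intro n
    have h1 : AEStronglyMeasurable (fun y => cellChar (-n) y * f y)
        (Measure.map (torusSection d) volume) := by
      rw [hs.map_eq]
      exact (contDiff_cellChar _).continuous.aestronglyMeasurable.mul hf.1
    rw [cellCoeff, ← hs.map_eq, integral_map hs.measurable.aemeasurable h1]
    refine integral_congr_ae ?_
    filter_upwards [hF.coeFn_toLp] with t ht
    rw [ht, ← mFourier_coe, coe_torusSection]
    rfl
  have hi : ∫ t, ‖(hF.toLp _ : UnitAddTorus (Fin d) → ℂ) t‖ ^ 2 = ∫ y in unitCell d, ‖f y‖ ^ 2 := by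
    have h1 : AEStronglyMeasurable (fun y => ‖f y‖ ^ 2)
        (Measure.map (torusSection d) volume) := by
      rw [hs.map_eq]
      exact hf.1.norm.pow 2
    rw [← hs.map_eq, integral_map hs.measurable.aemeasurable h1]
    refine integral_congr_ae ?_
    filter_upwards [hF.coeFn_toLp] with t ht
    rw [ht]
    rfl
  simpa only [hc, hi] using key

/-! ### Integration of periodic derivatives -/

theorem integral_unitCell_eq {d : ℕ} {F : Type*} [NormedAddCommGroup F] [NormedSpace ℝ F]
    (f : EuclideanSpace ℝ (Fin d) → F) :
    ∫ y in unitCell d, f y = ∫ x in Set.Icc (0 : Fin d → ℝ) 1, f (WithLp.toLp 2 x) := by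
  have h := (PiLp.volume_preserving_toLp (Fin d)).setIntegral_preimage_emb
    (MeasurableEquiv.toLp 2 (Fin d → ℝ)).measurableEmbedding f (unitCell d)
  rw [← h, unitCell_eq_preimage]
  refine setIntegral_congr_set ?_
  exact Measure.univ_pi_Ioo_ae_eq_Icc (μ := fun _ : Fin d => (volume : Measure ℝ))
    (f := fun _ => 0) (g := fun _ => 1)

/-- The partial derivatives of a periodic function have mean zero. -/
theorem integral_unitCell_fderiv_eq_zero {d : ℕ} {φ : EuclideanSpace ℝ (Fin d) → ℝ}
    (hφ : ContDiff ℝ ∞ φ) (hp : IsYPeriodic φ) (k : Fin d) :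
    ∫ y in unitCell d, fderiv ℝ φ y (EuclideanSpace.single k 1) = 0 := by
  obtain ⟨n, rfl⟩ : ∃ n, d = n + 1 := ⟨d - 1, by have := k.pos; omega⟩
  rw [integral_unitCell_eq]
  let e : (Fin (n + 1) → ℝ) →L[ℝ] EuclideanSpace ℝ (Fin (n + 1)) :=
    (PiLp.continuousLinearEquiv 2 ℝ (fun _ : Fin (n + 1) => ℝ)).symm
  have he : ∀ x, e x = WithLp.toLp 2 x := fun x => rfl
  have hcont : Continuous fun x : Fin (n + 1) → ℝ =>
      fderiv ℝ φ (e x) (EuclideanSpace.single k 1) :=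
    ((hφ.continuous_fderiv (by simp)).comp e.continuous).clm_apply continuous_const
  have hsum : ∀ x : Fin (n + 1) → ℝ, ∑ i, (if i = k then (fderiv ℝ φ (e x)).comp e else 0)
      (Pi.single i 1) = fderiv ℝ φ (e x) (EuclideanSpace.single k 1) := by
    intro x
    rw [Finset.sum_eq_single k (fun i _ hi => by simp [hi]) (by simp)]
    simp only [if_true, ContinuousLinearMap.comp_apply]
    rfl
  -- The divergence theorem is applied to the field with $k$-th component $\varphi$ and all others
  -- zero. Periodicity then cancels the two faces orthogonal to $e_k$.
  have key := integral_divergence_of_hasFDerivAt_off_countable' (0 : Fin (n + 1) → ℝ) 1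
    zero_le_one (fun i x => if i = k then φ (e x) else 0)
    (fun i x => if i = k then (fderiv ℝ φ (e x)).comp e else 0) ∅ Set.countable_empty
    (by
      intro i
      by_cases h : i = k
      · simp only [h, if_true]
        exact (hφ.continuous.comp e.continuous).continuousOn
      · simp only [h, if_false]
        exact continuousOn_const)
    (by
      intro x _ i
      by_cases h : i = k
      · simp only [h, if_true]
        exact ((hφ.differentiable (by simp)) (e x)).hasFDerivAt.comp x e.hasFDerivAt
      · simp only [h, if_false]
        exact hasFDerivAt_const _ _)
    (by
      simp only [hsum]
      exact hcont.continuousOn.integrableOn_compact isCompact_Icc)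
  simp only [hsum] at key
  refine key.trans (Finset.sum_eq_zero fun i _ => ?_)
  by_cases h : i = k
  · subst h
    rw [sub_eq_zero]
    refine integral_congr_ae (Filter.Eventually.of_forall fun x => ?_)
    simp only [if_true]
    rw [← hp (e (i.insertNth ((0 : Fin (n + 1) → ℝ) i) x)) i]
    congr 1
    ext j
    refine Fin.succAboveCases i ?_ (fun j => ?_) j
    · simp [he]
    · simp [he]
  · simp [h]

/-- Multiplication by a continuous function preserves integrability of square integrable
functions on the unit cell. -/
theorem integrable_mul_continuous {d : ℕ} {𝕜 : Type*} [RCLike 𝕜]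
    {u f : EuclideanSpace ℝ (Fin d) → 𝕜}
    (hu : MemLp u 2 (volume.restrict (unitCell d))) (hf : Continuous f) :
    Integrable (fun y => u y * f y) (volume.restrict (unitCell d)) :=
  hu.integrable_mul (memLp_unitCell_of_continuous hf 2)

theorem continuous_fderiv_single {d : ℕ} {φ : EuclideanSpace ℝ (Fin d) → ℝ}
    (hφ : ContDiff ℝ ∞ φ) (k : Fin d) :
    Continuous fun y => fderiv ℝ φ y (EuclideanSpace.single k 1) :=
  (hφ.continuous_fderiv (by simp)).clm_apply continuous_const

/-! ### Weak gradients, their Fourier coefficients and Poincaré's inequality -/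

/-- Complex valued periodic test functions. -/
theorem IsWeakGradient.complex_test {d : ℕ} {u : EuclideanSpace ℝ (Fin d) → ℝ}
    {g : EuclideanSpace ℝ (Fin d) → EuclideanSpace ℝ (Fin d)}
    (hu : MemLp u 2 (volume.restrict (unitCell d)))
    (hg : MemLp g 2 (volume.restrict (unitCell d))) (h : IsWeakGradient u g)
    {ψ : EuclideanSpace ℝ (Fin d) → ℂ} (hψ : ContDiff ℝ ∞ ψ)
    (hp : ∀ y k, ψ (y + EuclideanSpace.single k 1) = ψ y) (k : Fin d) :
    ∫ y in unitCell d, (u y : ℂ) * fderiv ℝ ψ y (EuclideanSpace.single k 1)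
      = - ∫ y in unitCell d, (g y k : ℂ) * ψ y := by
  have hgk : MemLp (fun y => g y k) 2 (volume.restrict (unitCell d)) :=
    (EuclideanSpace.proj (𝕜 := ℝ) k).comp_memLp' hg
  have i1 : Integrable (fun y => (u y : ℂ) * fderiv ℝ ψ y (EuclideanSpace.single k 1))
      (volume.restrict (unitCell d)) :=
    integrable_mul_continuous hu.ofReal
      ((hψ.continuous_fderiv (by simp)).clm_apply continuous_const)
  have i2 : Integrable (fun y => (g y k : ℂ) * ψ y) (volume.restrict (unitCell d)) :=
    integrable_mul_continuous hgk.ofReal hψ.continuous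
  -- The real test functions are $\operatorname{Re}\psi$ and $\operatorname{Im}\psi$; both cases are
  -- covered by a real-linear functional `L`.
  have main : ∀ L : ℂ →L[ℝ] ℝ, (∀ (r : ℝ) z, L (r * z) = r * L z) →
      L (∫ y in unitCell d, (u y : ℂ) * fderiv ℝ ψ y (EuclideanSpace.single k 1))
        = L (- ∫ y in unitCell d, (g y k : ℂ) * ψ y) := by
    intro L hL
    rw [map_neg, ← L.integral_comp_comm i1, ← L.integral_comp_comm i2]
    simp only [hL]
    rw [← h (fun y => L (ψ y)) (L.contDiff.comp hψ) (fun y k => congrArg L (hp y k)) k]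
    refine integral_congr_ae (Filter.Eventually.of_forall fun y => ?_)
    have := (L.hasFDerivAt.comp y ((hψ.differentiable (by simp)) y).hasFDerivAt).fderiv
    simp only [Function.comp_def] at this
    simp only [this, ContinuousLinearMap.comp_apply]
  apply Complex.ext
  · exact main Complex.reCLM (fun r z => by simp)
  · exact main Complex.imCLM (fun r z => by simp)

/-- The test function is the exponential of frequency $-n$. Its derivative brings down $-2\pi i
n_k$, and the sign is absorbed by the integration by parts. -/
theorem IsWeakGradient.cellCoeff_eq {d : ℕ} {u : EuclideanSpace ℝ (Fin d) → ℝ}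
    {g : EuclideanSpace ℝ (Fin d) → EuclideanSpace ℝ (Fin d)}
    (hu : MemLp u 2 (volume.restrict (unitCell d)))
    (hg : MemLp g 2 (volume.restrict (unitCell d))) (h : IsWeakGradient u g)
    (k : Fin d) (n : Fin d → ℤ) :
    cellCoeff (fun y => (g y k : ℂ)) n
      = 2 * Real.pi * Complex.I * n k * cellCoeff (fun y => (u y : ℂ)) n := by
  have := h.complex_test hu hg (contDiff_cellChar (-n)) (cellChar_add_single (-n)) k
  simp only [fderiv_cellChar] at this
  unfold cellCoeff
  rw [← neg_inj, ← integral_const_mul, ← integral_neg]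
  simp only [mul_comm (cellChar _ _) ((g _ k : ℂ)), integral_neg, ← this]
  rw [← integral_neg]
  congr 1
  ext y
  simp only [Pi.neg_apply, Int.cast_neg]
  ring

/-- Poincaré's inequality for periodic functions with mean zero. -/
theorem IsWeakGradient.poincare {d : ℕ} {u : EuclideanSpace ℝ (Fin d) → ℝ}
    {g : EuclideanSpace ℝ (Fin d) → EuclideanSpace ℝ (Fin d)}
    (hu : MemLp u 2 (volume.restrict (unitCell d)))
    (hg : MemLp g 2 (volume.restrict (unitCell d))) (h : IsWeakGradient u g)
    (h0 : ∫ y in unitCell d, u y = 0) :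
    ∫ y in unitCell d, ‖u y‖ ^ 2 ≤ ∫ y in unitCell d, ‖g y‖ ^ 2 := by
  have hgk : ∀ k, MemLp (fun y => g y k) 2 (volume.restrict (unitCell d)) :=
    fun k => (EuclideanSpace.proj (𝕜 := ℝ) k).comp_memLp' hg
  have hU := hasSum_sq_cellCoeff hu.ofReal
  have hG := fun k => hasSum_sq_cellCoeff (hgk k).ofReal
  have hGs := hasSum_sum (s := Finset.univ) fun k _ => hG k
  have e1 : ∑ k, ∫ y in unitCell d, ‖((g y k : ℝ) : ℂ)‖ ^ 2 = ∫ y in unitCell d, ‖g y‖ ^ 2 := by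
    rw [← integral_finsetSum]
    · refine integral_congr_ae (Filter.Eventually.of_forall fun y => ?_)
      simp [EuclideanSpace.norm_sq_eq]
    · intro k _
      exact (hgk k).ofReal.integrable_norm_pow (by simp)
  have e2 : ∫ y in unitCell d, ‖((u y : ℝ) : ℂ)‖ ^ 2 = ∫ y in unitCell d, ‖u y‖ ^ 2 := by
    simp
  rw [← e1, ← e2]
  refine hasSum_le (fun n => ?_) hU hGs
  -- The zero frequency is the only one the gradient does not control; there the mean-zero condition
  -- gives coefficient $0$. For $n\ne0$ one nonzero component $n_k$ suffices, as $2\pi|n_k|\ge1$.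
  by_cases hn : n = 0
  · have : cellCoeff (fun y => ((u y : ℝ) : ℂ)) n = 0 := by
      have hc : ∀ y : EuclideanSpace ℝ (Fin d), cellChar (-n) y = 1 := by
        intro y
        simp [cellChar, hn]
      simp only [cellCoeff, hc, one_mul]
      rw [integral_complex_ofReal, h0, Complex.ofReal_zero]
    change ‖cellCoeff (fun y => ((u y : ℝ) : ℂ)) n‖ ^ 2 ≤ _
    rw [this]
    rw [norm_zero, zero_pow two_ne_zero]
    exact Finset.sum_nonneg fun i _ => sq_nonneg _
  · obtain ⟨k, hk⟩ := Function.ne_iff.mp hn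
    refine le_trans ?_ (Finset.single_le_sum (fun i _ => sq_nonneg _) (Finset.mem_univ k))
    change ‖cellCoeff (fun y => ((u y : ℝ) : ℂ)) n‖ ^ 2
      ≤ ‖cellCoeff (fun y => ((g y k : ℝ) : ℂ)) n‖ ^ 2
    rw [h.cellCoeff_eq hu hg k n, norm_mul]
    gcongr
    refine le_mul_of_one_le_left (norm_nonneg _) ?_
    have h1 : (1 : ℝ) ≤ |(n k : ℝ)| := by
      exact_mod_cast Int.one_le_abs hk
    have h2 : (1 : ℝ) ≤ 2 * Real.pi := by linarith [Real.pi_gt_three]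
    simp only [norm_mul, Complex.norm_I, Complex.norm_intCast, Complex.norm_real,
      Real.norm_eq_abs, abs_of_pos Real.pi_pos, Complex.norm_two, mul_one]
    nlinarith

theorem ae_eq_zero_of_cellCoeff_eq_zero {d : ℕ} {f : EuclideanSpace ℝ (Fin d) → ℝ}
    (hf : MemLp f 2 (volume.restrict (unitCell d)))
    (h : ∀ n, cellCoeff (fun y => (f y : ℂ)) n = 0) :
    f =ᵐ[volume.restrict (unitCell d)] 0 := by
  have hs := hasSum_sq_cellCoeff hf.ofReal
  have h0 : ∫ y in unitCell d, ‖((f y : ℝ) : ℂ)‖ ^ 2 = 0 := by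
    refine hs.unique ?_
    convert hasSum_zero with n
    change ‖cellCoeff (fun y => ((f y : ℝ) : ℂ)) n‖ ^ 2 = 0
    simp [h n]
  rw [integral_eq_zero_iff_of_nonneg (fun y => by positivity)
    (hf.ofReal.integrable_norm_pow (by simp))] at h0
  filter_upwards [h0] with y hy
  simpa using hy

/-- Weak gradients are unique. -/
theorem IsWeakGradient.unique {d : ℕ} {u : EuclideanSpace ℝ (Fin d) → ℝ}
    {g g' : EuclideanSpace ℝ (Fin d) → EuclideanSpace ℝ (Fin d)}
    (hu : MemLp u 2 (volume.restrict (unitCell d)))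
    (hg : MemLp g 2 (volume.restrict (unitCell d)))
    (hg' : MemLp g' 2 (volume.restrict (unitCell d)))
    (h : IsWeakGradient u g) (h' : IsWeakGradient u g') :
    g =ᵐ[volume.restrict (unitCell d)] g' := by
  have key : ∀ k, (fun y => g y k - g' y k) =ᵐ[volume.restrict (unitCell d)] 0 := by
    intro k
    have hgk : MemLp (fun y => g y k) 2 (volume.restrict (unitCell d)) :=
      (EuclideanSpace.proj (𝕜 := ℝ) k).comp_memLp' hg
    have hgk' : MemLp (fun y => g' y k) 2 (volume.restrict (unitCell d)) :=
      (EuclideanSpace.proj (𝕜 := ℝ) k).comp_memLp' hg'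
    refine ae_eq_zero_of_cellCoeff_eq_zero (hgk.sub hgk') fun n => ?_
    have e1 := h.cellCoeff_eq hu hg k n
    rw [← h'.cellCoeff_eq hu hg' k n, ← sub_eq_zero] at e1
    rw [← e1]
    unfold cellCoeff
    rw [← integral_sub]
    · refine integral_congr_ae (Filter.Eventually.of_forall fun y => ?_)
      push_cast
      ring
    · exact (integrable_mul_continuous hgk.ofReal (contDiff_cellChar (-n)).continuous).congr
        (Filter.Eventually.of_forall fun y => mul_comm _ _)
    · exact (integrable_mul_continuous hgk'.ofReal (contDiff_cellChar (-n)).continuous).congr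
        (Filter.Eventually.of_forall fun y => mul_comm _ _)
  filter_upwards [ae_all_iff.mpr key] with y hy
  ext k
  exact sub_eq_zero.mp (hy k)

/-! ### Coercive variational problems in a Hilbert space -/

section Abstract

variable {H : Type*} [NormedAddCommGroup H] [InnerProductSpace ℝ H]

/-- Lax–Milgram on a closed subspace. -/
theorem exists_mem_forall_inner_eq_zero [CompleteSpace H] {V : Submodule ℝ H}
    (hV : IsClosed (V : Set H)) (B : H →L[ℝ] H) {α : ℝ} (hα : 0 < α)
    (hB : ∀ v, α * ‖v‖ ^ 2 ≤ inner ℝ v (B v)) (e : H) :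
    ∃ g ∈ V, ∀ v ∈ V, inner ℝ v (B (g + e)) = 0 := by
  have : CompleteSpace V := hV.completeSpace_coe
  let b : V →L[ℝ] V →L[ℝ] ℝ := (innerSL ℝ).bilinearComp (B ∘L V.subtypeL) V.subtypeL
  have hb : ∀ v w : V, b v w = inner ℝ (B v) (w : H) := fun v w => rfl
  have hc : IsCoercive b := by
    refine ⟨α, hα, fun v => ?_⟩
    rw [hb, real_inner_comm, mul_assoc, ← sq]
    exact hB v
  let f : V := (InnerProductSpace.toDual ℝ V).symm ((innerSL ℝ (B e)).comp V.subtypeL)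
  have hf : ∀ w : V, inner ℝ f w = inner ℝ (B e) (w : H) := fun w => by
    simp [f]
  let g : V := hc.continuousLinearEquivOfBilin.symm (-f)
  refine ⟨g, g.2, fun v hv => ?_⟩
  have h1 := hc.continuousLinearEquivOfBilin_apply g ⟨v, hv⟩
  rw [hb] at h1
  simp only [g, ContinuousLinearEquiv.apply_symm_apply, inner_neg_left, hf] at h1
  rw [map_add, inner_add_right, real_inner_comm, real_inner_comm (B e) v]
  simp only [g]
  linarith

/-- Testing the difference of the two equations with $g-g'\in V$ and using coercivity forces
$\|g-g'\|=0$. -/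
theorem eq_of_forall_inner_eq_zero {V : Submodule ℝ H} (B : H →L[ℝ] H) {α : ℝ} (hα : 0 < α)
    (hB : ∀ v, α * ‖v‖ ^ 2 ≤ inner ℝ v (B v)) {e g g' : H} (hg : g ∈ V) (hg' : g' ∈ V)
    (h : ∀ v ∈ V, inner ℝ v (B (g + e)) = 0) (h' : ∀ v ∈ V, inner ℝ v (B (g' + e)) = 0) :
    g = g' := by
  have h1 := hB (g - g')
  have h2 : B (g - g') = B (g + e) - B (g' + e) := by
    rw [← map_sub, add_sub_add_right_eq_sub]
  rw [h2, inner_sub_right, h _ (V.sub_mem hg hg'), h' _ (V.sub_mem hg hg'), sub_self] at h1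
  have h3 : ‖g - g'‖ ^ 2 = 0 := by
    refine le_antisymm ?_ (sq_nonneg _)
    by_contra hcon
    push Not at hcon
    nlinarith
  simpa [sub_eq_zero] using h3

/-- The fluxes of variational solutions depend continuously on the operator in the strong operator
topology. -/
theorem tendsto_flux {ι : Type*} {l : Filter ι} {V : Submodule ℝ H} {B : ι → H →L[ℝ] H}
    {B₀ : H →L[ℝ] H} {α β : ℝ} (hα : 0 < α) {e : H} {g : ι → H} {g₀ : H}
    (hB : ∀ᶠ i in l, ∀ v, α * ‖v‖ ^ 2 ≤ inner ℝ v (B i v))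
    (hβ : ∀ᶠ i in l, ‖B i‖ ≤ β)
    (hlim : ∀ v, Filter.Tendsto (fun i => B i v) l (nhds (B₀ v)))
    (hg : ∀ᶠ i in l, g i ∈ V) (hg₀ : g₀ ∈ V)
    (h : ∀ᶠ i in l, ∀ v ∈ V, inner ℝ v (B i (g i + e)) = 0)
    (h₀ : ∀ v ∈ V, inner ℝ v (B₀ (g₀ + e)) = 0) :
    Filter.Tendsto (fun i => B i (g i + e)) l (nhds (B₀ (g₀ + e))) := by
  have hr : Filter.Tendsto (fun i => ‖B i (g₀ + e) - B₀ (g₀ + e)‖) l (nhds 0) :=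
    tendsto_iff_norm_sub_tendsto_zero.mp (hlim (g₀ + e))
  rw [tendsto_iff_norm_sub_tendsto_zero]
  have hb : Filter.Tendsto (fun i => β * (α⁻¹ * ‖B i (g₀ + e) - B₀ (g₀ + e)‖)
      + ‖B i (g₀ + e) - B₀ (g₀ + e)‖) l (nhds 0) := by
    simpa using ((hr.const_mul α⁻¹).const_mul β).add hr
  refine tendsto_of_tendsto_of_tendsto_of_le_of_le' tendsto_const_nhds hb
    (Filter.Eventually.of_forall fun i => norm_nonneg _) ?_
  filter_upwards [hB, hβ, hg, h] with i hBi hβi hgi hi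
  set r := B i (g₀ + e) - B₀ (g₀ + e) with hrdef
  have hmem : g i - g₀ ∈ V := V.sub_mem hgi hg₀
  have e1 : B i (g i - g₀) = B i (g i + e) - B₀ (g₀ + e) - r := by
    rw [hrdef, ← add_sub_add_right_eq_sub (g i) g₀ e, map_sub]
    abel
  have h1 := hBi (g i - g₀)
  -- Both fluxes are orthogonal to $g_i-g_0\in V$, so only the residual `r` survives in the
  -- coercivity estimate.
  rw [e1, inner_sub_right, inner_sub_right, hi _ hmem, h₀ _ hmem] at h1
  have h2 : -inner ℝ (g i - g₀) r ≤ ‖g i - g₀‖ * ‖r‖ :=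
    (neg_le_abs _).trans (abs_real_inner_le_norm _ _)
  have h3 : ‖g i - g₀‖ ≤ α⁻¹ * ‖r‖ := by
    rw [inv_mul_eq_div, le_div_iff₀ hα]
    rcases (norm_nonneg (g i - g₀)).eq_or_lt with h0 | h0
    · rw [← h0, zero_mul]
      exact norm_nonneg _
    · nlinarith
  have e2 : B i (g i + e) - B₀ (g₀ + e) = B i (g i - g₀) + r := by
    rw [e1]
    abel
  calc ‖B i (g i + e) - B₀ (g₀ + e)‖ ≤ ‖B i (g i - g₀)‖ + ‖r‖ := by
        rw [e2]
        exact norm_add_le _ _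
    _ ≤ β * ‖g i - g₀‖ + ‖r‖ := by
        gcongr
        exact (B i).le_of_opNorm_le hβi _
    _ ≤ β * (α⁻¹ * ‖r‖) + ‖r‖ := by
        have : 0 ≤ β := (norm_nonneg _).trans hβi
        gcongr

end Abstract

/-! ### The closed space of periodic gradients -/

theorem IsWeakGradient.congr_ae {d : ℕ} {u u' : EuclideanSpace ℝ (Fin d) → ℝ}
    {g g' : EuclideanSpace ℝ (Fin d) → EuclideanSpace ℝ (Fin d)} (h : IsWeakGradient u g)
    (hu : u =ᵐ[volume.restrict (unitCell d)] u') (hg : g =ᵐ[volume.restrict (unitCell d)] g') :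
    IsWeakGradient u' g' := by
  intro φ hφ hp k
  have e1 : ∫ y in unitCell d, u' y * fderiv ℝ φ y (EuclideanSpace.single k 1)
      = ∫ y in unitCell d, u y * fderiv ℝ φ y (EuclideanSpace.single k 1) :=
    integral_congr_ae (by filter_upwards [hu] with y hy; rw [hy])
  have e2 : ∫ y in unitCell d, g' y k * φ y = ∫ y in unitCell d, g y k * φ y :=
    integral_congr_ae (by filter_upwards [hg] with y hy; rw [hy])
  rw [e1, e2, h φ hφ hp k]

theorem IsWeakGradient.sub_const {d : ℕ} {u : EuclideanSpace ℝ (Fin d) → ℝ}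
    {g : EuclideanSpace ℝ (Fin d) → EuclideanSpace ℝ (Fin d)} (h : IsWeakGradient u g)
    (hu : MemLp u 2 (volume.restrict (unitCell d))) (c : ℝ) :
    IsWeakGradient (fun y => u y - c) g := by
  intro φ hφ hp k
  rw [← h φ hφ hp k]
  have hc := continuous_fderiv_single hφ k
  simp only [sub_mul]
  rw [integral_sub (integrable_mul_continuous hu hc)
    (((memLp_unitCell_of_continuous hc 1).integrable le_rfl).const_mul c),
    integral_const_mul, integral_unitCell_fderiv_eq_zero hφ hp, mul_zero, sub_zero]

/-- The space `L²(Y)`. -/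
abbrev CellL2 (d : ℕ) (F : Type*) [NormedAddCommGroup F] : Type _ :=
  Lp F 2 (volume.restrict (unitCell d))

/-- A continuous function as an element of `L²(Y)`. -/
noncomputable def contToL2 {d : ℕ} {F : Type*} [NormedAddCommGroup F]
    [SecondCountableTopologyEither (EuclideanSpace ℝ (Fin d)) F]
    (f : EuclideanSpace ℝ (Fin d) → F) (hf : Continuous f) : CellL2 d F :=
  (memLp_unitCell_of_continuous hf 2).toLp f

theorem inner_contToL2 {d : ℕ} {F : Type*} [NormedAddCommGroup F] [InnerProductSpace ℝ F]
    [SecondCountableTopologyEither (EuclideanSpace ℝ (Fin d)) F]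
    {f : EuclideanSpace ℝ (Fin d) → F} (hf : Continuous f) (u : CellL2 d F) :
    inner ℝ (contToL2 f hf) u = ∫ y in unitCell d, inner ℝ (f y) (u y) := by
  rw [L2.inner_def]
  refine integral_congr_ae ?_
  filter_upwards [(memLp_unitCell_of_continuous hf 2).coeFn_toLp] with y hy
  rw [contToL2, hy]

theorem norm_sq_eq_integral {d : ℕ} {F : Type*} [NormedAddCommGroup F] [InnerProductSpace ℝ F]
    (u : CellL2 d F) : ‖u‖ ^ 2 = ∫ y in unitCell d, ‖u y‖ ^ 2 := by
  rw [← real_inner_self_eq_norm_sq, L2.inner_def]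
  simp only [real_inner_self_eq_norm_sq]

/-- Each test function contributes the vanishing of one continuous functional of $(u,g)$, so the
relation is linear and closed in $L^2\times L^2$. -/
theorem isWeakGradient_iff_inner {d : ℕ} (u : CellL2 d ℝ)
    (g : CellL2 d (EuclideanSpace ℝ (Fin d))) :
    IsWeakGradient u g ↔ ∀ φ : EuclideanSpace ℝ (Fin d) → ℝ, ∀ hφ : ContDiff ℝ ∞ φ,
      IsYPeriodic φ → ∀ k, inner ℝ (contToL2 _ (continuous_fderiv_single hφ k)) u
        + inner ℝ (contToL2 (fun y => φ y • EuclideanSpace.single k (1 : ℝ))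
          (hφ.continuous.smul continuous_const)) g = 0 := by
  refine forall_congr' fun φ => forall_congr' fun hφ => forall_congr' fun _ =>
    forall_congr' fun k => ?_
  rw [inner_contToL2, inner_contToL2, ← eq_neg_iff_add_eq_zero]
  simp only [inner_smul_left, EuclideanSpace.inner_single_left, map_one, one_mul, conj_trivial,
    RCLike.inner_apply, mul_comm]

/-- The pairs `(u, ∇u)` with `u ∈ H¹_per(Y)` of mean zero. -/
noncomputable def gradientGraph (d : ℕ) :
    Submodule ℝ (CellL2 d ℝ × CellL2 d (EuclideanSpace ℝ (Fin d))) where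
  carrier := {p | IsWeakGradient p.1 p.2 ∧ inner ℝ (contToL2 (fun _ => (1 : ℝ))
    continuous_const) p.1 = 0}
  zero_mem' := by
    refine ⟨(isWeakGradient_iff_inner _ _).mpr ?_, by simp⟩
    intros
    simp
  add_mem' := by
    rintro p q ⟨hp, hp'⟩ ⟨hq, hq'⟩
    rw [isWeakGradient_iff_inner] at hp hq
    refine ⟨(isWeakGradient_iff_inner _ _).mpr fun φ hφ hper k => ?_, ?_⟩
    · have h1 := hp φ hφ hper k
      have h2 := hq φ hφ hper k
      simp only [Prod.fst_add, Prod.snd_add, inner_add_right]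
      linarith
    · rw [Prod.fst_add, inner_add_right, hp', hq', add_zero]
  smul_mem' := by
    rintro c p ⟨hp, hp'⟩
    rw [isWeakGradient_iff_inner] at hp
    refine ⟨(isWeakGradient_iff_inner _ _).mpr fun φ hφ hper k => ?_, ?_⟩
    · have h1 := hp φ hφ hper k
      simp only [Prod.smul_fst, Prod.smul_snd, inner_smul_right]
      rw [← mul_add, h1, mul_zero]
    · rw [Prod.smul_fst, inner_smul_right, hp', mul_zero]

theorem isClosed_gradientGraph (d : ℕ) :
    IsClosed (gradientGraph d : Set (CellL2 d ℝ × CellL2 d (EuclideanSpace ℝ (Fin d)))) := by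
  have : (gradientGraph d : Set (CellL2 d ℝ × CellL2 d (EuclideanSpace ℝ (Fin d))))
      = {p | (∀ φ : EuclideanSpace ℝ (Fin d) → ℝ, ∀ hφ : ContDiff ℝ ∞ φ,
      IsYPeriodic φ → ∀ k, inner ℝ (contToL2 _ (continuous_fderiv_single hφ k)) p.1
        + inner ℝ (contToL2 (fun y => φ y • EuclideanSpace.single k (1 : ℝ))
          (hφ.continuous.smul continuous_const)) p.2 = 0) ∧
        inner ℝ (contToL2 (fun _ => (1 : ℝ)) continuous_const) p.1 = 0} := by
    ext p
    exact and_congr (isWeakGradient_iff_inner p.1 p.2) Iff.rfl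
  rw [this]
  simp only [Set.ofPred_and, Set.ofPred_forall]
  refine IsClosed.inter ?_ (isClosed_eq (by fun_prop) continuous_const)
  exact isClosed_iInter fun φ => isClosed_iInter fun hφ => isClosed_iInter fun _ =>
    isClosed_iInter fun k => isClosed_eq (by fun_prop) continuous_const

theorem integral_eq_inner_one {d : ℕ} (u : CellL2 d ℝ) :
    inner ℝ (contToL2 (fun _ => (1 : ℝ)) continuous_const) u = ∫ y in unitCell d, u y := by
  rw [inner_contToL2]
  simp

/-- The gradients of the functions in `H¹_per(Y)`. -/
noncomputable def gradientSpace (d : ℕ) : Submodule ℝ (CellL2 d (EuclideanSpace ℝ (Fin d))) :=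
  (gradientGraph d).map (LinearMap.snd ℝ _ _)

/-- By Poincaré, the projection $(u,\nabla u)\mapsto\nabla u$ is bounded below on the complete
graph, so its range is closed. The constant is $1$ because the product carries the maximum norm and
$\|u\|\le\|\nabla u\|$. -/
theorem isClosed_gradientSpace (d : ℕ) :
    IsClosed (gradientSpace d : Set (CellL2 d (EuclideanSpace ℝ (Fin d)))) := by
  have : CompleteSpace (gradientGraph d) := (isClosed_gradientGraph d).completeSpace_coe
  let S : gradientGraph d →L[ℝ] CellL2 d (EuclideanSpace ℝ (Fin d)) :=
    (ContinuousLinearMap.snd ℝ _ _).comp (gradientGraph d).subtypeL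
  have hS : AntilipschitzWith 1 S := by
    refine ContinuousLinearMap.antilipschitz_of_bound S fun p => ?_
    obtain ⟨⟨u, g⟩, hp, hp0⟩ := p
    rw [integral_eq_inner_one] at hp0
    have h := hp.poincare (Lp.memLp u) (Lp.memLp g) hp0
    change ∫ y in unitCell d, ‖u y‖ ^ 2 ≤ ∫ y in unitCell d, ‖g y‖ ^ 2 at h
    rw [← norm_sq_eq_integral, ← norm_sq_eq_integral] at h
    have h2 : ‖u‖ ≤ ‖g‖ := le_of_sq_le_sq h (norm_nonneg _)
    rw [NNReal.coe_one, one_mul]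
    exact max_le h2 (le_refl ‖g‖)
  have := hS.isClosed_range S.uniformContinuous
  convert this using 1
  ext g
  simp [gradientSpace, S]

theorem mem_gradientSpace_iff {d : ℕ} {g : CellL2 d (EuclideanSpace ℝ (Fin d))} :
    g ∈ gradientSpace d ↔
      ∃ u : CellL2 d ℝ, IsWeakGradient u g ∧ ∫ y in unitCell d, u y = 0 := by
  constructor
  · rintro ⟨⟨u, g'⟩, ⟨h, h0⟩, rfl⟩
    exact ⟨u, h, (integral_eq_inner_one u).symm.trans h0⟩
  · rintro ⟨u, h, h0⟩
    exact ⟨(u, g), ⟨h, (integral_eq_inner_one u).trans h0⟩, rfl⟩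

theorem MemH1per.memLp_weakGradient {d : ℕ} {u : EuclideanSpace ℝ (Fin d) → ℝ}
    (hu : MemH1per u) : MemLp (weakGradient u) 2 (volume.restrict (unitCell d)) := by
  rw [weakGradient, dif_pos hu.exists_grad]
  exact hu.exists_grad.choose_spec.1

theorem MemH1per.isWeakGradient {d : ℕ} {u : EuclideanSpace ℝ (Fin d) → ℝ}
    (hu : MemH1per u) : IsWeakGradient u (weakGradient u) := by
  rw [weakGradient, dif_pos hu.exists_grad]
  exact hu.exists_grad.choose_spec.2

theorem volume_unitCell (d : ℕ) : (volume.restrict (unitCell d)).real Set.univ = 1 := by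
  have := integral_unitCell_eq (d := d) (fun _ => (1 : ℝ))
  rw [integral_const, setIntegral_const] at this
  simpa [measureReal_def, Real.volume_Icc_pi] using this

theorem MemH1per.toLp_mem_gradientSpace {d : ℕ} {u : EuclideanSpace ℝ (Fin d) → ℝ}
    (hu : MemH1per u) : hu.memLp_weakGradient.toLp _ ∈ gradientSpace d := by
  set m := ∫ y in unitCell d, u y with hm
  have hL : MemLp (fun y => u y - m) 2 (volume.restrict (unitCell d)) :=
    hu.memLp.sub (memLp_const m)
  refine mem_gradientSpace_iff.mpr ⟨hL.toLp _, ?_, ?_⟩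
  · exact (hu.isWeakGradient.sub_const hu.memLp m).congr_ae hL.coeFn_toLp.symm
      hu.memLp_weakGradient.coeFn_toLp.symm
  · rw [integral_congr_ae hL.coeFn_toLp,
      integral_sub (hu.memLp.integrable (by norm_num)) (integrable_const m), integral_const,
      volume_unitCell, one_smul, ← hm, sub_self]

/-- Every element of the gradient space is the gradient of a periodic function of mean zero. -/
theorem exists_memH1per_of_mem_gradientSpace {d : ℕ}
    {g : CellL2 d (EuclideanSpace ℝ (Fin d))} (hg : g ∈ gradientSpace d) :
    ∃ w, ∃ hw : MemH1per w, ∫ y in unitCell d, w y = 0 ∧ hw.memLp_weakGradient.toLp _ = g := by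
  obtain ⟨u, hu, hu0⟩ := mem_gradientSpace_iff.mp hg
  -- The representative of `u` need not be periodic. Composing with the fractional part makes it so
  -- without changing it on $(0,1)^d$.
  let w : EuclideanSpace ℝ (Fin d) → ℝ := fun y => u (WithLp.toLp 2 fun k => Int.fract (y k))
  have hwu : u =ᵐ[volume.restrict (unitCell d)] w := by
    filter_upwards [ae_restrict_mem (measurableSet_unitCell d)] with y hy
    simp only [w]
    congr 1
    ext k
    exact (Int.fract_eq_self.mpr ⟨(hy k).1.le, (hy k).2⟩).symm
  have hgrad : IsWeakGradient w g := hu.congr_ae hwu Filter.EventuallyEq.rfl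
  have hw : MemH1per w := by
    refine ⟨fun y k => ?_, (memLp_congr_ae hwu).mp (Lp.memLp u), g, Lp.memLp g, hgrad⟩
    simp only [w]
    congr 2
    ext i
    by_cases h : i = k
    · subst h
      simp
    · simp [h]
  refine ⟨w, hw, (integral_congr_ae hwu).symm.trans hu0, ?_⟩
  refine Lp.ext (hw.memLp_weakGradient.coeFn_toLp.trans ?_)
  exact hw.isWeakGradient.unique hw.memLp hw.memLp_weakGradient (Lp.memLp g) hgrad

/-- A function in `H¹_per(Y)` of mean zero is determined by its gradient. -/
theorem MemH1per.ae_eq_of_weakGradient_ae_eq {d : ℕ} {u w : EuclideanSpace ℝ (Fin d) → ℝ}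
    (hu : MemH1per u) (hw : MemH1per w) (hu0 : ∫ y in unitCell d, u y = 0)
    (hw0 : ∫ y in unitCell d, w y = 0)
    (h : weakGradient u =ᵐ[volume.restrict (unitCell d)] weakGradient w) :
    u =ᵐ[volume.restrict (unitCell d)] w := by
  have hL : MemLp (fun y => u y - w y) 2 (volume.restrict (unitCell d)) := hu.memLp.sub hw.memLp
  have hg : IsWeakGradient (fun y => u y - w y) 0 := by
    intro φ hφ hp k
    have e1 := hu.isWeakGradient.congr_ae Filter.EventuallyEq.rfl h φ hφ hp k
    have e2 := hw.isWeakGradient φ hφ hp k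
    have hc := continuous_fderiv_single hφ k
    simp only [sub_mul]
    rw [integral_sub (integrable_mul_continuous hu.memLp hc)
      (integrable_mul_continuous hw.memLp hc), e1, e2]
    simp
  have h0 : ∫ y in unitCell d, (u y - w y) = 0 := by
    rw [integral_sub (hu.memLp.integrable (by norm_num)) (hw.memLp.integrable (by norm_num)),
      hu0, hw0, sub_self]
  have h1 := hg.poincare hL MemLp.zero h0
  have h2 : ∫ y in unitCell d, ‖u y - w y‖ ^ 2 = 0 := by
    refine le_antisymm (h1.trans_eq (by simp)) (integral_nonneg fun y => sq_nonneg _)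
  rw [integral_eq_zero_iff_of_nonneg (fun y => sq_nonneg _)
    (hL.integrable_norm_pow (by simp))] at h2
  filter_upwards [h2] with y hy
  simpa [sub_eq_zero] using hy

/-! ### Multiplication operators and the cell problem -/

/-- Measurable, coercive and bounded coefficients on the unit cell. -/
structure IsAdmissible {d : ℕ} (α β : ℝ)
    (b : EuclideanSpace ℝ (Fin d) → Matrix (Fin d) (Fin d) ℝ) : Prop where
  aemeasurable : ∀ i j, AEMeasurable (fun y => b y i j) (volume.restrict (unitCell d))
  coercive : ∀ᵐ y ∂(volume.restrict (unitCell d)), ∀ ξ : EuclideanSpace ℝ (Fin d),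
    α * ‖ξ‖ ^ 2 ≤ inner ℝ ξ (Matrix.toEuclideanLin (b y) ξ)
  bounded : ∀ᵐ y ∂(volume.restrict (unitCell d)), ∀ ξ : EuclideanSpace ℝ (Fin d),
    ‖Matrix.toEuclideanLin (b y) ξ‖ ≤ β * ‖ξ‖

/-- `B` is the operator of multiplication by `b` in `L²(Y)`. -/
def IsMulOperator {d : ℕ} (b : EuclideanSpace ℝ (Fin d) → Matrix (Fin d) (Fin d) ℝ)
    (B : CellL2 d (EuclideanSpace ℝ (Fin d)) →L[ℝ] CellL2 d (EuclideanSpace ℝ (Fin d))) : Prop :=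
  ∀ f, B f =ᵐ[volume.restrict (unitCell d)] fun y => Matrix.toEuclideanLin (b y) (f y)

theorem aestronglyMeasurable_toEuclideanLin {d : ℕ}
    {b : EuclideanSpace ℝ (Fin d) → Matrix (Fin d) (Fin d) ℝ}
    {f : EuclideanSpace ℝ (Fin d) → EuclideanSpace ℝ (Fin d)}
    {μ : Measure (EuclideanSpace ℝ (Fin d))}
    (hb : ∀ i j, AEMeasurable (fun y => b y i j) μ) (hf : AEStronglyMeasurable f μ) :
    AEStronglyMeasurable (fun y => Matrix.toEuclideanLin (b y) (f y)) μ := by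
  have hfm : ∀ j, AEMeasurable (fun y => f y j) μ := fun j =>
    (EuclideanSpace.proj (𝕜 := ℝ) j).continuous.measurable.comp_aemeasurable hf.aemeasurable
  have h1 : AEMeasurable (fun y i => ∑ j, b y i j * f y j) μ :=
    aemeasurable_pi_lambda _ fun i => Finset.aemeasurable_fun_sum _ fun j _ =>
      (hb i j).mul (hfm j)
  have h2 := (WithLp.measurable_toLp 2 (Fin d → ℝ)).comp_aemeasurable h1
  exact h2.aestronglyMeasurable

/-- The bound is $|\beta|$ because $\beta$ may be negative when $d=0$, where all norms vanish. -/
theorem IsAdmissible.exists_mulOperator {d : ℕ} {α β : ℝ}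
    {b : EuclideanSpace ℝ (Fin d) → Matrix (Fin d) (Fin d) ℝ} (hb : IsAdmissible α β b) :
    ∃ B, IsMulOperator b B ∧ ‖B‖ ≤ |β| := by
  have hmem : ∀ f : CellL2 d (EuclideanSpace ℝ (Fin d)),
      MemLp (fun y => Matrix.toEuclideanLin (b y) (f y)) 2 (volume.restrict (unitCell d)) := by
    intro f
    refine MemLp.of_le_mul (Lp.memLp f)
      (aestronglyMeasurable_toEuclideanLin hb.aemeasurable (Lp.aestronglyMeasurable f)) (c := β) ?_
    filter_upwards [hb.bounded] with y hy
    exact hy _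
  let T : CellL2 d (EuclideanSpace ℝ (Fin d)) →ₗ[ℝ] CellL2 d (EuclideanSpace ℝ (Fin d)) :=
    { toFun := fun f => (hmem f).toLp _
      map_add' := fun f g => by
        rw [← MemLp.toLp_add]
        refine MemLp.toLp_congr _ _ ?_
        filter_upwards [Lp.coeFn_add f g] with y hy
        rw [hy, Pi.add_apply, map_add]
        rfl
      map_smul' := fun c f => by
        rw [RingHom.id_apply, ← MemLp.toLp_const_smul]
        refine MemLp.toLp_congr _ _ ?_
        filter_upwards [Lp.coeFn_smul c f] with y hy
        rw [hy, Pi.smul_apply, map_smul]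
        rfl }
  have hT : ∀ f, ‖T f‖ ≤ |β| * ‖f‖ := by
    intro f
    refine Lp.norm_le_mul_norm_of_ae_le_mul ?_
    filter_upwards [(hmem f).coeFn_toLp, hb.bounded] with y hy hy'
    change ‖((hmem f).toLp _ : EuclideanSpace ℝ (Fin d) → EuclideanSpace ℝ (Fin d)) y‖ ≤ _
    rw [hy]
    exact (hy' _).trans (mul_le_mul_of_nonneg_right (le_abs_self β) (norm_nonneg _))
  exact ⟨T.mkContinuous |β| hT, fun f => (hmem f).coeFn_toLp,
    T.mkContinuous_norm_le (abs_nonneg β) hT⟩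

section Operator

variable {d : ℕ} {b : EuclideanSpace ℝ (Fin d) → Matrix (Fin d) (Fin d) ℝ}
  {B : CellL2 d (EuclideanSpace ℝ (Fin d)) →L[ℝ] CellL2 d (EuclideanSpace ℝ (Fin d))}

theorem IsMulOperator.inner_eq (hB : IsMulOperator b B)
    (v f : CellL2 d (EuclideanSpace ℝ (Fin d))) :
    inner ℝ v (B f) = ∫ y in unitCell d, inner ℝ (v y) (Matrix.toEuclideanLin (b y) (f y)) := by
  rw [L2.inner_def]
  refine integral_congr_ae ?_
  filter_upwards [hB f] with y hy
  rw [hy]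

theorem IsMulOperator.inner_toLp_eq (hB : IsMulOperator b B)
    {v f : EuclideanSpace ℝ (Fin d) → EuclideanSpace ℝ (Fin d)}
    (hv : MemLp v 2 (volume.restrict (unitCell d)))
    (hf : MemLp f 2 (volume.restrict (unitCell d))) :
    inner ℝ (hv.toLp v) (B (hf.toLp f))
      = ∫ y in unitCell d, inner ℝ (v y) (Matrix.toEuclideanLin (b y) (f y)) := by
  rw [hB.inner_eq]
  refine integral_congr_ae ?_
  filter_upwards [hv.coeFn_toLp, hf.coeFn_toLp] with y h1 h2
  rw [h1, h2]

theorem IsMulOperator.coercive (hB : IsMulOperator b B) {α β : ℝ} (hb : IsAdmissible α β b)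
    (v : CellL2 d (EuclideanSpace ℝ (Fin d))) : α * ‖v‖ ^ 2 ≤ inner ℝ v (B v) := by
  rw [norm_sq_eq_integral, ← integral_const_mul, L2.inner_def]
  refine integral_mono_ae ?_ (L2.integrable_inner v (B v)) ?_
  · exact ((Lp.memLp v).integrable_norm_pow (by simp)).const_mul α
  · filter_upwards [hB v, hb.coercive] with y hy hy'
    rw [hy]
    exact hy' _

/-- The cell problem in terms of the multiplication operator. -/
theorem IsMulOperator.isCellSolution_iff (hB : IsMulOperator b B) (j : Fin d)
    {w : EuclideanSpace ℝ (Fin d) → ℝ} (hw : MemH1per w) (hw0 : ∫ y in unitCell d, w y = 0) :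
    IsCellSolution b j w ↔ ∀ v ∈ gradientSpace d,
      inner ℝ v (B (hw.memLp_weakGradient.toLp _
        + contToL2 (fun _ => EuclideanSpace.single j (1 : ℝ)) continuous_const)) = 0 := by
  constructor
  · intro h v hv
    obtain ⟨φ, hφ, -, rfl⟩ := exists_memH1per_of_mem_gradientSpace hv
    rw [map_add, inner_add_right, contToL2, hB.inner_toLp_eq, hB.inner_toLp_eq,
      h.weak_eq φ hφ, neg_add_cancel]
  · intro h
    refine ⟨hw, hw0, fun φ hφ => ?_⟩
    have := h _ hφ.toLp_mem_gradientSpace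
    rw [map_add, inner_add_right, contToL2, hB.inner_toLp_eq, hB.inner_toLp_eq] at this
    exact eq_neg_of_add_eq_zero_left this

theorem IsAdmissible.exists_isCellSolution {α β : ℝ} (hα : 0 < α) (hb : IsAdmissible α β b)
    (j : Fin d) : ∃ w, IsCellSolution b j w ∧
      ∀ w', IsCellSolution b j w' → w' =ᵐ[volume.restrict (unitCell d)] w := by
  obtain ⟨B, hB, -⟩ := hb.exists_mulOperator
  obtain ⟨g, hg, hgB⟩ := exists_mem_forall_inner_eq_zero (isClosed_gradientSpace d) B hα
    (hB.coercive hb) (contToL2 (fun _ => EuclideanSpace.single j (1 : ℝ)) continuous_const)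
  obtain ⟨w, hw, hw0, rfl⟩ := exists_memH1per_of_mem_gradientSpace hg
  refine ⟨w, (hB.isCellSolution_iff j hw hw0).mpr hgB, fun w' hw' => ?_⟩
  have h' := (hB.isCellSolution_iff j hw'.memH1per hw'.mean_zero).mp hw'
  have heq := eq_of_forall_inner_eq_zero B hα (hB.coercive hb)
    hw'.memH1per.toLp_mem_gradientSpace hg h' hgB
  exact hw'.memH1per.ae_eq_of_weakGradient_ae_eq hw hw'.mean_zero hw0
    ((MemLp.toLp_eq_toLp_iff _ _).mp heq)

/-- The averaged coefficient in terms of the multiplication operator. -/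
theorem IsMulOperator.exists_averagedCoeff_eq (hB : IsMulOperator b B) {α β : ℝ} (hα : 0 < α)
    (hb : IsAdmissible α β b) (j : Fin d) : ∃ g ∈ gradientSpace d,
      (∀ v ∈ gradientSpace d, inner ℝ v
        (B (g + contToL2 (fun _ => EuclideanSpace.single j (1 : ℝ)) continuous_const)) = 0) ∧
      ∀ i, averagedCoeff b i j
        = inner ℝ (contToL2 (fun _ => EuclideanSpace.single i (1 : ℝ)) continuous_const)
        (B (g + contToL2 (fun _ => EuclideanSpace.single j (1 : ℝ)) continuous_const)) := by
  have hex : ∃ w, IsCellSolution b j w := by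
    obtain ⟨w, hw, -⟩ := hb.exists_isCellSolution hα j
    exact ⟨w, hw⟩
  have hw : IsCellSolution b j (cellSolution b j) := by
    rw [cellSolution, dif_pos hex]
    exact hex.choose_spec
  refine ⟨_, hw.memH1per.toLp_mem_gradientSpace,
    (hB.isCellSolution_iff j hw.memH1per hw.mean_zero).mp hw, fun i => ?_⟩
  rw [contToL2, contToL2, ← MemLp.toLp_add, hB.inner_toLp_eq]
  rfl

end Operator

/-! ### Continuous dependence on the coefficients -/

/-- Multiplication operators converge strongly if the coefficients converge almost everywhere in
the sense that they are eventually equal. -/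
theorem tendsto_mulOperator {d : ℕ} {ι : Type*} {l : Filter ι} [l.IsCountablyGenerated] {α β : ℝ}
    {b : ι → EuclideanSpace ℝ (Fin d) → Matrix (Fin d) (Fin d) ℝ}
    {b₀ : EuclideanSpace ℝ (Fin d) → Matrix (Fin d) (Fin d) ℝ}
    {B : ι → CellL2 d (EuclideanSpace ℝ (Fin d)) →L[ℝ] CellL2 d (EuclideanSpace ℝ (Fin d))}
    {B₀ : CellL2 d (EuclideanSpace ℝ (Fin d)) →L[ℝ] CellL2 d (EuclideanSpace ℝ (Fin d))}
    (hb : ∀ᶠ i in l, IsAdmissible α β (b i)) (hb₀ : IsAdmissible α β b₀)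
    (hB : ∀ᶠ i in l, IsMulOperator (b i) (B i)) (hB₀ : IsMulOperator b₀ B₀)
    (hlim : ∀ᵐ y ∂(volume.restrict (unitCell d)), ∀ᶠ i in l, b i y = b₀ y)
    (f : CellL2 d (EuclideanSpace ℝ (Fin d))) :
    Filter.Tendsto (fun i => B i f) l (nhds (B₀ f)) := by
  let F : ι → EuclideanSpace ℝ (Fin d) → ℝ := fun i y =>
    ‖Matrix.toEuclideanLin (b i y) (f y) - Matrix.toEuclideanLin (b₀ y) (f y)‖ ^ 2
  have hF : Filter.Tendsto (fun i => ∫ y in unitCell d, F i y) l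
      (nhds (∫ y in unitCell d, (0 : ℝ))) := by
    refine tendsto_integral_filter_of_dominated_convergence
      (fun y => (2 * β) ^ 2 * ‖f y‖ ^ 2) ?_ ?_ ?_ ?_
    · filter_upwards [hb] with i hi
      exact (((aestronglyMeasurable_toEuclideanLin hi.aemeasurable
        (Lp.aestronglyMeasurable f)).sub (aestronglyMeasurable_toEuclideanLin hb₀.aemeasurable
        (Lp.aestronglyMeasurable f))).norm).pow 2
    · filter_upwards [hb] with i hi
      filter_upwards [hi.bounded, hb₀.bounded] with y h1 h2
      rw [Real.norm_of_nonneg (sq_nonneg _), ← mul_pow]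
      refine pow_le_pow_left₀ (norm_nonneg _) ((norm_sub_le _ _).trans ?_) 2
      linarith [h1 (f y), h2 (f y)]
    · exact ((Lp.memLp f).integrable_norm_pow (by simp)).const_mul _
    · filter_upwards [hlim] with y hy
      refine tendsto_const_nhds.congr' ?_
      filter_upwards [hy] with i hi
      simp [F, hi]
  rw [integral_zero] at hF
  have hsq : Filter.Tendsto (fun i => ‖B i f - B₀ f‖ ^ 2) l (nhds 0) := by
    refine hF.congr' ?_
    filter_upwards [hB] with i hi
    rw [norm_sq_eq_integral]
    refine integral_congr_ae ?_
    filter_upwards [Lp.coeFn_sub (B i f) (B₀ f), hi f, hB₀ f] with y h1 h2 h3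
    simp only [F]
    rw [h1, Pi.sub_apply, h2, h3]
  rw [tendsto_iff_norm_sub_tendsto_zero]
  have := hsq.sqrt
  simpa [Real.sqrt_sq (norm_nonneg _)] using this

/-- The averaged coefficients depend continuously on the coefficients. -/
theorem continuousOn_averagedCoeff {d : ℕ} {X : Type*} [TopologicalSpace X]
    [FirstCountableTopology X] {s : Set X} {α β : ℝ} (hα : 0 < α)
    {b : X → EuclideanSpace ℝ (Fin d) → Matrix (Fin d) (Fin d) ℝ}
    (hb : ∀ x ∈ s, IsAdmissible α β (b x))
    (hlim : ∀ x₀ ∈ s, ∀ᵐ y ∂(volume.restrict (unitCell d)), ∀ᶠ x in nhdsWithin x₀ s,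
      b x y = b x₀ y) (i j : Fin d) :
    ContinuousOn (fun x => averagedCoeff (b x) i j) s := by
  have h1 : ∀ x, ∃ B, x ∈ s → IsMulOperator (b x) B ∧ ‖B‖ ≤ |β| := by
    intro x
    by_cases hx : x ∈ s
    · obtain ⟨B, hB⟩ := (hb x hx).exists_mulOperator
      exact ⟨B, fun _ => hB⟩
    · exact ⟨0, fun h => absurd h hx⟩
  choose B hB using h1
  have h2 : ∀ x, ∃ g, x ∈ s → g ∈ gradientSpace d ∧
      (∀ v ∈ gradientSpace d, inner ℝ v
        (B x (g + contToL2 (fun _ => EuclideanSpace.single j (1 : ℝ)) continuous_const)) = 0) ∧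
      ∀ i, averagedCoeff (b x) i j
        = inner ℝ (contToL2 (fun _ => EuclideanSpace.single i (1 : ℝ)) continuous_const)
        (B x (g + contToL2 (fun _ => EuclideanSpace.single j (1 : ℝ)) continuous_const)) := by
    intro x
    by_cases hx : x ∈ s
    · obtain ⟨g, hg⟩ := (hB x hx).1.exists_averagedCoeff_eq hα (hb x hx) j
      exact ⟨g, fun _ => hg⟩
    · exact ⟨0, fun h => absurd h hx⟩
  choose g hg using h2
  intro x₀ hx₀
  have hs : ∀ᶠ x in nhdsWithin x₀ s, x ∈ s := self_mem_nhdsWithin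
  have hflux := tendsto_flux hα (e := contToL2 (fun _ => EuclideanSpace.single j (1 : ℝ))
      continuous_const) (l := nhdsWithin x₀ s) (B := B) (B₀ := B x₀) (β := |β|)
    (V := gradientSpace d) (g := g) (g₀ := g x₀)
    (hs.mono fun x hx => (hB x hx).1.coercive (hb x hx)) (hs.mono fun x hx => (hB x hx).2)
    (tendsto_mulOperator (hs.mono hb) (hb x₀ hx₀) (hs.mono fun x hx => (hB x hx).1)
      (hB x₀ hx₀).1 (hlim x₀ hx₀))
    (hs.mono fun x hx => (hg x hx).1) (hg x₀ hx₀).1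
    (hs.mono fun x hx => (hg x hx).2.1) (hg x₀ hx₀).2.1
  have := (tendsto_const_nhds (x := contToL2 (fun _ => EuclideanSpace.single i (1 : ℝ))
    continuous_const)).inner (𝕜 := ℝ) hflux
  rw [ContinuousWithinAt, (hg x₀ hx₀).2.2 i]
  refine this.congr' ?_
  filter_upwards [hs] with x hx
  rw [(hg x hx).2.2 i]

/-! ### Periodic representatives in a moving cube -/

theorem measurable_toIcoMod {p : ℝ} (hp : 0 < p) (a : ℝ) : Measurable (toIcoMod hp a) := by
  have : toIcoMod hp a = fun b => b - ⌊(b - a) / p⌋ • p := by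
    ext b
    rw [toIcoMod, toIcoDiv_eq_floor]
  rw [this]
  simp only [zsmul_eq_mul]
  have h : Measurable fun b : ℝ => ⌊(b - a) / p⌋ :=
    Int.measurable_floor.comp ((measurable_id.sub_const a).div_const p)
  exact measurable_id.sub (((measurable_of_countable (fun n : ℤ => (n : ℝ))).comp h).mul_const p)

section Cube

variable {d : ℕ} {ε : ℝ} (hε : 0 < ε)

theorem measurable_cubeRep_smul (x : EuclideanSpace ℝ (Fin d)) :
    Measurable fun y : EuclideanSpace ℝ (Fin d) => cubeRep hε x (ε • y) := by
  unfold cubeRep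
  refine (WithLp.measurable_toLp 2 (Fin d → ℝ)).comp (measurable_pi_lambda _ fun k => ?_)
  refine (measurable_toIcoMod hε _).comp ?_
  simp only [PiLp.smul_apply]
  fun_prop

/-- The lattice translation used depends on $y$, but only countably many occur, and each map
$y\mapsto\varepsilon y-\varepsilon n$ pulls null sets back to null sets. -/
theorem ae_cubeRep_smul (x : EuclideanSpace ℝ (Fin d)) {P : EuclideanSpace ℝ (Fin d) → Prop}
    (h : ∀ᵐ z, P z) : ∀ᵐ y, P (cubeRep hε x (ε • y)) := by
  have h1 : ∀ n : Fin d → ℤ, ∀ᵐ y : EuclideanSpace ℝ (Fin d),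
      P (ε • y + WithLp.toLp 2 fun k => -(n k • ε)) := by
    intro n
    rw [ae_iff] at h ⊢
    change volume ((fun y => ε • y) ⁻¹'
      ((fun z => z + WithLp.toLp 2 fun k => -(n k • ε)) ⁻¹' {z | ¬ P z})) = 0
    rw [Measure.addHaar_preimage_smul _ hε.ne', measure_preimage_add_right, h, mul_zero]
  filter_upwards [ae_all_iff.mpr h1] with y hy
  convert hy fun k => toIcoDiv hε (x k - ε / 2) ((ε • y) k) using 1
  ext k
  simp only [cubeRep, toIcoMod, PiLp.add_apply]
  ring

theorem ae_apply_ne (k : Fin d) (c : ℝ) : ∀ᵐ z : EuclideanSpace ℝ (Fin d), z k ≠ c := by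
  have h := (PiLp.volume_preserving_ofLp (Fin d)).quasiMeasurePreserving.ae
    (p := fun z : Fin d → ℝ => z k ≠ c) (by
      rw [ae_iff]
      simp only [ne_eq, not_not]
      exact Measure.pi_hyperplane (fun _ : Fin d => (volume : Measure ℝ)) k c)
  exact h

theorem ae_cubeRep_mem_Ioo (x : EuclideanSpace ℝ (Fin d)) :
    ∀ᵐ y : EuclideanSpace ℝ (Fin d), ∀ k,
      cubeRep hε x (ε • y) k ∈ Set.Ioo (x k - ε / 2) (x k + ε / 2) := by
  -- Only the lower faces need excluding, since the half-open cube omits the upper ones; they lie in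
  -- null hyperplanes.
  filter_upwards [ae_cubeRep_smul hε x (ae_all_iff.mpr fun k => ae_apply_ne k (x k - ε / 2))]
    with y hy k
  have h := toIcoMod_mem_Ico hε (x k - ε / 2) ((ε • y) k)
  refine ⟨lt_of_le_of_ne h.1 (hy k).symm, h.2.trans_eq (by ring)⟩

theorem eventually_mem_Ioo {x r : EuclideanSpace ℝ (Fin d)}
    (hr : ∀ k, r k ∈ Set.Ioo (x k - ε / 2) (x k + ε / 2)) :
    ∀ᶠ x' in nhds x, ∀ k, r k ∈ Set.Ioo (x' k - ε / 2) (x' k + ε / 2) := by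
  rw [Filter.eventually_all]
  intro k
  have hc : Continuous fun x' : EuclideanSpace ℝ (Fin d) => x' k := by fun_prop
  filter_upwards [(hc.sub continuous_const).continuousAt.eventually_lt continuousAt_const (hr k).1,
    continuousAt_const.eventually_lt (hc.add continuous_const).continuousAt (hr k).2] with x' h1 h2
  exact ⟨h1, h2⟩

/-- An interior point of the cube stays inside under small shifts of the centre, and a half-open
cube contains only one point of each class modulo $\varepsilon\mathbb Z^d$. -/
theorem eventually_cubeRep_eq {x z : EuclideanSpace ℝ (Fin d)}
    (h : ∀ k, cubeRep hε x z k ∈ Set.Ioo (x k - ε / 2) (x k + ε / 2)) :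
    ∀ᶠ x' in nhds x, cubeRep hε x' z = cubeRep hε x z := by
  filter_upwards [eventually_mem_Ioo h] with x' hx'
  ext k
  change toIcoMod hε (x' k - ε / 2) (z k) = cubeRep hε x z k
  refine (toIcoMod_eq_iff hε).mpr ⟨⟨(hx' k).1.le, (hx' k).2.trans_eq (by ring)⟩,
    toIcoDiv hε (x k - ε / 2) (z k), ?_⟩
  exact (toIcoMod_add_toIcoDiv_zsmul hε _ _).symm

variable {Ω Ω' : Set (EuclideanSpace ℝ (Fin d))}

/-- For $x\in\partial\Omega$ the inclusion of $W(x)$ is not assumed. An interior point of $W(x)$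
nevertheless lies in $W(x')$ for all $x'$ near $x$, and some such $x'$ belongs to $\Omega$. -/
theorem ae_cubeRep_mem (hcube : ∀ x ∈ Ω, cube ε x ⊆ Ω') {x : EuclideanSpace ℝ (Fin d)}
    (hx : x ∈ closure Ω) : ∀ᵐ y : EuclideanSpace ℝ (Fin d), cubeRep hε x (ε • y) ∈ Ω' := by
  filter_upwards [ae_cubeRep_mem_Ioo hε x] with y hy
  obtain ⟨x', hx', hmem⟩ :=
    ((mem_closure_iff_frequently.mp hx).and_eventually (eventually_mem_Ioo hy)).exists
  exact hcube x' hx' fun k => ⟨(hmem k).1.le, (hmem k).2⟩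

theorem ae_restrict_cubeRep (hΩ' : IsOpen Ω') (hcube : ∀ x ∈ Ω, cube ε x ⊆ Ω')
    {x : EuclideanSpace ℝ (Fin d)} (hx : x ∈ closure Ω) {P : EuclideanSpace ℝ (Fin d) → Prop}
    (h : ∀ᵐ z ∂(volume.restrict Ω'), P z) :
    ∀ᵐ y ∂(volume.restrict (unitCell d)), P (cubeRep hε x (ε • y)) := by
  rw [ae_restrict_iff' hΩ'.measurableSet] at h
  refine ae_restrict_of_ae ?_
  filter_upwards [ae_cubeRep_smul hε x h, ae_cubeRep_mem hε hcube hx] with y h1 h2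
  exact h1 h2

/-- Needed because `aM` is only almost everywhere measurable on $\Omega'$: its exceptional null set
must pull back to a null set. -/
theorem quasiMeasurePreserving_cubeRep (hΩ' : IsOpen Ω') (hcube : ∀ x ∈ Ω, cube ε x ⊆ Ω')
    {x : EuclideanSpace ℝ (Fin d)} (hx : x ∈ closure Ω) :
    Measure.QuasiMeasurePreserving (fun y => cubeRep hε x (ε • y))
      (volume.restrict (unitCell d)) (volume.restrict Ω') := by
  refine ⟨measurable_cubeRep_smul hε x, Measure.AbsolutelyContinuous.mk fun s hs h0 => ?_⟩
  rw [Measure.map_apply (measurable_cubeRep_smul hε x) hs]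
  have h : ∀ᵐ z ∂(volume.restrict Ω'), z ∉ s := measure_eq_zero_iff_ae_notMem.mp h0
  exact measure_eq_zero_iff_ae_notMem.mpr (ae_restrict_cubeRep hε hΩ' hcube hx h)

theorem isAdmissible_continuousExtension (hΩ' : IsOpen Ω') (hcube : ∀ x ∈ Ω, cube ε x ⊆ Ω')
    {aM : EuclideanSpace ℝ (Fin d) → Matrix (Fin d) (Fin d) ℝ}
    (haM : ∀ i j, AEMeasurable (fun z => aM z i j) (volume.restrict Ω')) {α β : ℝ}
    (hcoer : ∀ᵐ z ∂(volume.restrict Ω'), ∀ ξ : EuclideanSpace ℝ (Fin d),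
      α * ‖ξ‖ ^ 2 ≤ inner ℝ ξ (Matrix.toEuclideanLin (aM z) ξ))
    (hbdd : ∀ᵐ z ∂(volume.restrict Ω'), ∀ ξ : EuclideanSpace ℝ (Fin d),
      ‖Matrix.toEuclideanLin (aM z) ξ‖ ≤ β * ‖ξ‖)
    {x : EuclideanSpace ℝ (Fin d)} (hx : x ∈ closure Ω) :
    IsAdmissible α β (continuousExtension hε aM x) where
  aemeasurable i j :=
    (haM i j).comp_quasiMeasurePreserving (quasiMeasurePreserving_cubeRep hε hΩ' hcube hx)
  coercive := ae_restrict_cubeRep hε hΩ' hcube hx hcoer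
  bounded := ae_restrict_cubeRep hε hΩ' hcube hx hbdd

end Cube

end TwoScale

theorem mainTheorem6 (d : ℕ) (Ω Ω' : Set (EuclideanSpace ℝ (Fin d)))
    (hΩ : IsOpen Ω) (hΩb : Bornology.IsBounded Ω)
    (hΩ' : IsOpen Ω') (hΩ'b : Bornology.IsBounded Ω')
    (ε : ℝ) (hε : 0 < ε) (hcube : ∀ x ∈ Ω, TwoScale.cube ε x ⊆ Ω')
    (aM : EuclideanSpace ℝ (Fin d) → Matrix (Fin d) (Fin d) ℝ)
    (haM : ∀ i j, AEMeasurable (fun z => aM z i j) (volume.restrict Ω'))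
    (α β : ℝ) (hα : 0 < α)
    (hcoer : ∀ᵐ z ∂(volume.restrict Ω'), ∀ ξ : EuclideanSpace ℝ (Fin d),
      α * ‖ξ‖ ^ 2 ≤ inner ℝ ξ (Matrix.toEuclideanLin (aM z) ξ))
    (hbdd : ∀ᵐ z ∂(volume.restrict Ω'), ∀ ξ : EuclideanSpace ℝ (Fin d),
      ‖Matrix.toEuclideanLin (aM z) ξ‖ ≤ β * ‖ξ‖) :
    (∀ x ∈ closure Ω, ∀ j : Fin d,
      ∃ w, TwoScale.IsCellSolution (TwoScale.continuousExtension hε aM x) j w ∧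
        ∀ w', TwoScale.IsCellSolution (TwoScale.continuousExtension hε aM x) j w' →
          w' =ᵐ[volume.restrict (TwoScale.unitCell d)] w) ∧
    ∀ i j : Fin d,
      ContinuousOn (fun x => TwoScale.averagedCoeff (TwoScale.continuousExtension hε aM x) i j)
        (closure Ω) := by
  have hadm := fun x (hx : x ∈ closure Ω) =>
    TwoScale.isAdmissible_continuousExtension hε hΩ' hcube haM hcoer hbdd hx
  refine ⟨fun x hx j => (hadm x hx).exists_isCellSolution hα j, fun i j =>
    TwoScale.continuousOn_averagedCoeff hα hadm (fun x₀ _ => ?_) i j⟩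
  -- For almost every $y$ the representative is interior to $W(x_0)$, hence unchanged for nearby
  -- centres; no regularity of `aM` enters.
  filter_upwards [ae_restrict_of_ae (TwoScale.ae_cubeRep_mem_Ioo hε x₀)] with y hy
  filter_upwards [nhdsWithin_le_nhds (TwoScale.eventually_cubeRep_eq hε hy)] with x hx
  exact congrArg aM hx
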